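/- **Setting.** Let $U,B,L,V$ be pairwise disjoint, countably infinite, ordered sets (URIs, blank nodes, literals, variables). An RDF triple is an element of $(U\cup B)\times U\times(U\cup B\cup L)$. A *Web of Linked Data* is a tuple $W=(D,\mathrm{data},\mathrm{adoc})$ where $D$ is a finite or countably infinite set of documents, $\mathrm{data}$ assigns to each $d\in D$ a finite set of RDF triples such that different documents have different sets of blank nodes, and $\mathrm{adoc}:U\rightharpoonup D$ is a partial surjective mapping. A *valuation* is a partial mapping $V\rightharpoonup U\cup B\cup L$. For a SPARQL expression $P$ (built from triple patterns by AND, UNION, OPT and FILTER, with the usual set semantics $[\![P]\!]_G$ over a possibly infinite set $G$ of triples), the SPARQL$_{LD}$ query $\mathcal Q^P$ maps each Web $W$ to the set of valuations $\mathcal Q^P(W)=[\![P]\!]_{\bigcup_{d\in D}\mathrm{data}(d)}$; it is *satisfiable* if $\mathcal Q^P(W)\neq\emptyset$ for some Web $W$. An *LD machine* is a multi-tape Turing machine with a read-only input tape, a Web tape that contains the (possibly infinite) word of all records $\sharp\,\mathrm{enc}(u)\,\mathrm{enc}(\mathrm{adoc}(u))\,\sharp$, $u\in\mathrm{dom}(\mathrm{adoc})$,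 a two-way infinite work tape, a right-infinite link traversal tape, and an append-only output tape. The Web tape can be accessed only in a special *expand* state: if the word on the link traversal tape ends in $\mathrm{enc}(u)$ with $u\in\mathrm{dom}(\mathrm{adoc})$, then $\mathrm{enc}(\mathrm{adoc}(u))\,\sharp$ is appended to that word, and otherwise $\sharp$ is appended. A decision problem whose instances are pairs $(W,X)$ of a Web $W$ and a finite structure $X$ is *LD machine decidable* if there is a single LD machine that, for all $W$ encoded on the Web tape and all $X$ encoded on the input tape, halts in an accepting state if the answer is yes and halts in a rejecting state if the answer is no. An LD machine *eventually computes* a query $\mathcal Q$ if, for every Web $W$ (and empty input), its output is at each step a prefix of a possible encoding of $\mathcal Q(W)$, and $\mathrm{enc}(\mu)$ becomes part of its output after finitely many steps for each $\mu\in\mathcal Q(W)$. **Theorem.** The problem Termination(SPARQL$_{LD}$) (given a Web of Linked Data $W$, finite or infinite, and a satisfiable SPARQL$_{LD}$ query $\mathcal Q^P$: does an LD machine exist that computes $\mathcal Q^P(W)$ and halts?) is not LD machine decidable. This holds for both readings of the question: 1. Does an LD machine exist that eventually computes $\mathcal Q^P$ (over all Webs) and that, with $W$ on its Web tape, halts after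 finitely many steps with an encoding of $\mathcal Q^P(W)$ on its output tape? 2. Does an LD machine exist that, with $W$ on its Web tape, halts after finitely many steps with an encoding of $\mathcal Q^P(W)$ on its output tape (with no requirement on its behaviour on other Webs)? -/

import Mathlib

namespace LinkedData

noncomputable section

/-! ## RDF terms, triples, and valuations

The four vocabularies are disjoint copies of the natural numbers, that is, pairwise disjoint
countably infinite sets, each one with a fixed total order of its elements. -/

/-- HTTP scheme based URIs. -/
structure URI where
  idx : ℕ

/-- Blank nodes. -/
structure BNode where
  idx : ℕ

/-- Literals. -/
structure Lit where
  idx : ℕ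

/-- Query variables. -/
structure QVar where
  idx : ℕ

/-- An element of the disjoint union of the URIs, the blank nodes and the literals. -/
inductive Term where
  | uri (u : URI)
  | bnode (b : BNode)
  | lit (c : Lit)

/-- A possible subject of an RDF triple: a URI or a blank node. -/
inductive Subj where
  | uri (u : URI)
  | bnode (b : BNode)

def Subj.toTerm : Subj → Term
  | .uri u => .uri u
  | .bnode b => .bnode b

/-- RDF triples: elements of `(U ∪ B) × U × (U ∪ B ∪ L)`. -/
structure Triple where
  s : Subj
  p : URI
  o : Term

/-- The set of all terms of a triple. -/
def Triple.terms (t : Triple) : Set Term := {t.s.toTerm, .uri t.p, t.o}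

/-- The set of blank nodes that occur in a set of triples. -/
def bnodesOf (G : Set Triple) : Set BNode := {b | ∃ t ∈ G, Term.bnode b ∈ t.terms}

/-- Valuations: partial mappings from variables to terms (`none` stands for unbound). -/
def Valuation : Type := QVar → Option Term

def Valuation.dom (μ : Valuation) : Set QVar := {v | (μ v).isSome}

/-- Two valuations are compatible if they agree on every variable bound by both of them. -/
def Valuation.Compatible (μ ν : Valuation) : Prop := ∀ v, v ∈ μ.dom → v ∈ ν.dom → μ v = ν v

/-- The union of two (compatible) valuations. -/
def Valuation.union (μ ν : Valuation) : Valuation := fun v => (μ v).or (ν v)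

/-! ## SPARQL expressions and their evaluation -/

/-- Subject or predicate position of a triple pattern: a variable or a URI. -/
inductive PatSP where
  | var (v : QVar)
  | uri (u : URI)

/-- Object position of a triple pattern: a variable, a URI, or a literal. -/
inductive PatO where
  | var (v : QVar)
  | uri (u : URI)
  | lit (c : Lit)

/-- Constants of filter conditions: URIs and literals. -/
inductive FConst where
  | uri (u : URI)
  | lit (c : Lit)

def FConst.toTerm : FConst → Term
  | .uri u => .uri u
  | .lit c => .lit c

structure TriplePattern where
  s : PatSP
  p : PatSP
  o : PatO

/-- SPARQL filter conditions. -/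
inductive FilterCond where
  | eqConst (x : QVar) (c : FConst)
  | eqVar (x y : QVar)
  | bound (x : QVar)
  | neg (R : FilterCond)
  | conj (R₁ R₂ : FilterCond)
  | disj (R₁ R₂ : FilterCond)

/-- SPARQL expressions. -/
inductive Expr where
  | triple (tp : TriplePattern)
  | and (P₁ P₂ : Expr)
  | union (P₁ P₂ : Expr)
  | opt (P₁ P₂ : Expr)
  | filter (P : Expr) (R : FilterCond)

def PatSP.vars : PatSP → Set QVar
  | .var v => {v}
  | .uri _ => ∅

def PatO.vars : PatO → Set QVar
  | .var v => {v}
  | .uri _ => ∅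
  | .lit _ => ∅

def TriplePattern.vars (tp : TriplePattern) : Set QVar := tp.s.vars ∪ tp.p.vars ∪ tp.o.vars

/-- The term that a position of a triple pattern becomes under a valuation. -/
def PatSP.subst (μ : Valuation) : PatSP → Option Term
  | .var v => μ v
  | .uri u => some (.uri u)

def PatO.subst (μ : Valuation) : PatO → Option Term
  | .var v => μ v
  | .uri u => some (.uri u)
  | .lit c => some (.lit c)

/-- `μ[tp] = t`: replacing the variables of `tp` according to `μ` gives the triple `t`. -/
def TriplePattern.InstanceEq (μ : Valuation) (tp : TriplePattern) (t : Triple) : Prop :=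
  tp.s.subst μ = some t.s.toTerm ∧ tp.p.subst μ = some (.uri t.p) ∧ tp.o.subst μ = some t.o

/-- A valuation satisfies a filter condition. -/
def FilterCond.Sat (μ : Valuation) : FilterCond → Prop
  | .eqConst x c => μ x = some c.toTerm
  | .eqVar x y => x ∈ μ.dom ∧ y ∈ μ.dom ∧ μ x = μ y
  | .bound x => x ∈ μ.dom
  | .neg R => ¬ R.Sat μ
  | .conj R₁ R₂ => R₁.Sat μ ∧ R₂.Sat μ
  | .disj R₁ R₂ => R₁.Sat μ ∨ R₂.Sat μ

def joinVals (A B : Set Valuation) : Set Valuation :=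
  {μ | ∃ l ∈ A, ∃ r ∈ B, l.Compatible r ∧ μ = l.union r}

def diffVals (A B : Set Valuation) : Set Valuation :=
  {μ | μ ∈ A ∧ ∀ r ∈ B, ¬ μ.Compatible r}

def leftJoinVals (A B : Set Valuation) : Set Valuation := joinVals A B ∪ diffVals A B

/-- The evaluation of a SPARQL expression over a (potentially infinite) set of triples. -/
def Expr.eval (G : Set Triple) : Expr → Set Valuation
  | .triple tp => {μ | μ.dom = tp.vars ∧ ∃ t ∈ G, tp.InstanceEq μ t}
  | .and P₁ P₂ => joinVals (P₁.eval G) (P₂.eval G)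
  | .union P₁ P₂ => P₁.eval G ∪ P₂.eval G
  | .opt P₁ P₂ => leftJoinVals (P₁.eval G) (P₂.eval G)
  | .filter P R => {μ | μ ∈ P.eval G ∧ R.Sat μ}

/-! ## Webs of Linked Data and queries over them -/

/-- A Web of Linked Data `(D, data, adoc)`; the value `none` of `adoc` stands for undefined. -/
structure Web where
  D : Type
  countable_D : Countable D
  data : D → Finset Triple
  data_bnodes : ∀ d₁ d₂ : D, d₁ ≠ d₂ →
    bnodesOf (data d₁ : Set Triple) ≠ bnodesOf (data d₂ : Set Triple)
  adoc : URI → Option D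
  adoc_surj : ∀ d : D, ∃ u : URI, adoc u = some d

/-- The set of all RDF triples in a Web of Linked Data. -/
def Web.allData (W : Web) : Set Triple := {t | ∃ d : W.D, t ∈ W.data d}

/-- A Linked Data query. -/
abbrev LDQuery := Web → Set Valuation

def LDQuery.Satisfiable (q : LDQuery) : Prop := ∃ W : Web, (q W).Nonempty

/-- The SPARQL query that uses the expression `P`, under full-Web semantics. -/
def fullWebQuery (P : Expr) : LDQuery := fun W => P.eval W.allData

/-! ## Encodings as words -/

/-- The symbols that occur in encodings. -/
inductive Sym where
  | zero | one
  | hash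
  | langle | rangle
  | llangle | rrangle
  | comma | arrow
  | lpar | rpar
  | and | union | opt | filter
  | eq | bound | neg | conj | disj

instance : Finite Sym := by
  let f : Sym → Fin 20 := fun x => ⟨x.ctorIdx, by cases x <;> decide⟩
  refine Finite.of_injective f ?_
  intro x y h
  cases x <;> cases y <;> first | rfl | (exact absurd h (by decide))

def bitSym : Bool → Sym
  | false => .zero
  | true => .one

/-- Binary representation of an index, least significant bit first. -/
def encNat (n : ℕ) : List Sym := n.bits.map bitSym

/-! The binary representation of a URI, blank node, literal or variable consists of two bits for
its kind, followed by the binary representation of its index. -/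

def encURI (u : URI) : List Sym := .zero :: .zero :: encNat u.idx
def encBNode (b : BNode) : List Sym := .zero :: .one :: encNat b.idx
def encLit (c : Lit) : List Sym := .one :: .zero :: encNat c.idx
def encVar (v : QVar) : List Sym := .one :: .one :: encNat v.idx

def encTerm : Term → List Sym
  | .uri u => encURI u
  | .bnode b => encBNode b
  | .lit c => encLit c

def encTriple (t : Triple) : List Sym :=
  [.langle] ++ encTerm t.s.toTerm ++ [.comma] ++ encURI t.p ++ [.comma] ++ encTerm t.o ++ [.rangle]

/-! Triples are ordered lexicographically by their components, where URIs come before blank nodes,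
and blank nodes before literals. -/

def Term.key : Term → ℕ ×ₗ ℕ
  | .uri u => toLex (0, u.idx)
  | .bnode b => toLex (1, b.idx)
  | .lit c => toLex (2, c.idx)

def Triple.key (t : Triple) : (ℕ ×ₗ ℕ) ×ₗ (ℕ ×ₗ (ℕ ×ₗ ℕ)) :=
  toLex (t.s.toTerm.key, toLex (t.p.idx, t.o.key))

theorem Term.key_injective : Function.Injective Term.key := by
  rintro (⟨u⟩ | ⟨u⟩ | ⟨u⟩) (⟨v⟩ | ⟨v⟩ | ⟨v⟩) h <;>
    first
    | (simp [Term.key] at h; done)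
    | (cases u; cases v; simp_all [Term.key])

theorem Subj.toTerm_injective : Function.Injective Subj.toTerm := by
  rintro (u | u) (v | v) h <;> simp [Subj.toTerm] at h ⊢ <;> exact h

theorem Triple.key_injective : Function.Injective Triple.key := by
  rintro ⟨s, ⟨p⟩, o⟩ ⟨s', ⟨p'⟩, o'⟩ h
  simp only [Triple.key, EmbeddingLike.apply_eq_iff_eq, Prod.mk.injEq] at h
  obtain ⟨h1, h2, h3⟩ := h
  have e1 := Subj.toTerm_injective (Term.key_injective h1)
  have e3 := Term.key_injective h3
  subst e1 h2 e3
  rfl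

instance : LinearOrder Triple := LinearOrder.lift' Triple.key Triple.key_injective

instance : LinearOrder QVar :=
  LinearOrder.lift' QVar.idx (fun a b h => by cases a; cases b; simp at h; simp [h])

/-- The encoding of a finite set of triples, which is also the encoding of a document with these
data. -/
def encTriples (T : Finset Triple) : List Sym :=
  [.llangle] ++ List.intercalate [.comma] (T.sort.map encTriple) ++ [.rrangle]

/-- The part `♯ enc(u) enc(adoc(u)) ♯` of the encoding of a Web for the URI `u` with index `n`
(empty if `adoc(u)` is undefined). -/
def webRecord (W : Web) (n : ℕ) : List Sym :=
  match W.adoc ⟨n⟩ with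
  | none => []
  | some d => [.hash] ++ encURI ⟨n⟩ ++ encTriples (W.data d) ++ [.hash]

/-- The records of the first `n` URIs, in order. -/
def webInitial (W : Web) (n : ℕ) : List Sym := (List.range n).flatMap (webRecord W)

open Classical in
/-- The (finite or infinite) word that encodes the Web `W`, as the contents of a right-infinite
tape: the concatenation of the records of all URIs, in order, followed by blanks if it is finite. -/
def webTape (W : Web) (k : ℕ) : Option Sym :=
  if h : ∃ n, k < (webInitial W n).length then (webInitial W (Nat.find h))[k]? else none

/-- A tape contains a word as a contiguous subword. -/
def TapeContains (tape : ℕ → Option Sym) (w : List Sym) : Prop :=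
  ∃ k, ∀ i (h : i < w.length), tape (k + i) = some w[i]

open Classical in
/-- The encoding of a valuation with finite domain. (Solutions of SPARQL expressions always have a
finite domain.) -/
def encVal (μ : Valuation) : List Sym :=
  if h : μ.dom.Finite then
    [.llangle] ++ List.intercalate [.comma]
      (h.toFinset.sort.map fun v => encVar v ++ [.arrow] ++ ((μ v).map encTerm).getD [])
      ++ [.rrangle]
  else []

/-- The finite word `w` is a possible encoding of the set `Ω` of valuations (which then is finite):
the encodings of the elements of `Ω` in some order. -/
def IsEncoding (Ω : Set Valuation) (w : List Sym) : Prop :=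
  ∃ l : List Valuation, l.Nodup ∧ (∀ μ, μ ∈ l ↔ μ ∈ Ω) ∧ w = l.flatMap encVal

/-- The finite word `w` is an initial segment of a possible (finite or infinite) encoding of the set
`Ω` of valuations. -/
def IsInitialOfEncoding (Ω : Set Valuation) (w : List Sym) : Prop :=
  (∃ x, IsEncoding Ω x ∧ w <+: x) ∨
  (∃ e : ℕ → Valuation, Function.Injective e ∧ Set.range e = Ω ∧
    ∃ n, w <+: (List.range n).flatMap fun i => encVal (e i))

def encPatSP : PatSP → List Sym
  | .var v => encVar v
  | .uri u => encURI u

def encPatO : PatO → List Sym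
  | .var v => encVar v
  | .uri u => encURI u
  | .lit c => encLit c

def encFilterCond : FilterCond → List Sym
  | .eqConst x c => [.lpar] ++ encVar x ++ [.eq] ++ encTerm c.toTerm ++ [.rpar]
  | .eqVar x y => [.lpar] ++ encVar x ++ [.eq] ++ encVar y ++ [.rpar]
  | .bound x => [.lpar, .bound] ++ encVar x ++ [.rpar]
  | .neg R => [.lpar, .neg] ++ encFilterCond R ++ [.rpar]
  | .conj R₁ R₂ => [.lpar] ++ encFilterCond R₁ ++ [.conj] ++ encFilterCond R₂ ++ [.rpar]
  | .disj R₁ R₂ => [.lpar] ++ encFilterCond R₁ ++ [.disj] ++ encFilterCond R₂ ++ [.rpar]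

/-- The encoding of a SPARQL expression. -/
def encExpr : Expr → List Sym
  | .triple tp =>
      [.langle] ++ encPatSP tp.s ++ [.comma] ++ encPatSP tp.p ++ [.comma] ++ encPatO tp.o
        ++ [.rangle]
  | .and P₁ P₂ => [.lpar] ++ encExpr P₁ ++ [.and] ++ encExpr P₂ ++ [.rpar]
  | .union P₁ P₂ => [.lpar] ++ encExpr P₁ ++ [.union] ++ encExpr P₂ ++ [.rpar]
  | .opt P₁ P₂ => [.lpar] ++ encExpr P₁ ++ [.opt] ++ encExpr P₂ ++ [.rpar]
  | .filter P R => [.lpar] ++ encExpr P ++ [.filter] ++ encFilterCond R ++ [.rpar]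

/-! ## LD machines -/

/-- A cell of a work tape: blank (`none`), a symbol of encodings, or one of the additional work
symbols of the machine. -/
abbrev Cell (Γ : Type) := Option (Sym ⊕ Γ)

/-- A right-infinite tape with its head. -/
structure RTape (α : Type) where
  cells : ℕ → Option α
  head : ℕ

namespace RTape

variable {α : Type}

def blank : RTape α := ⟨fun _ => none, 0⟩

def read (T : RTape α) : Option α := T.cells T.head

def write (T : RTape α) (a : Option α) : RTape α := ⟨Function.update T.cells T.head a, T.head⟩

/-- Move the head, or keep it (`none`); the head cannot leave the tape at its left end. -/
def move (T : RTape α) : Option Turing.Dir → RTape α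
  | none => T
  | some .left => ⟨T.cells, T.head - 1⟩
  | some .right => ⟨T.cells, T.head + 1⟩

/-- The first position after the last nonblank cell. -/
def wordEnd (T : RTape α) : ℕ := sInf {n | ∀ m, n ≤ m → T.cells m = none}

/-- The word currently stored on the tape. -/
def word (T : RTape α) : List (Option α) := (List.range T.wordEnd).map T.cells

/-- Append a word to the right end of the word on the tape; the head keeps its position. -/
def append (T : RTape α) (w : List α) : RTape α :=
  ⟨fun i => if i < T.wordEnd then T.cells i else w[i - T.wordEnd]?, T.head⟩

end RTape

/-- Move the head of a two-way infinite tape, or keep it (`none`). -/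
def moveTape {α : Type} [Inhabited α] (T : Turing.Tape α) : Option Turing.Dir → Turing.Tape α
  | none => T
  | some d => T.move d

/-- What a machine does in one ordinary step: go to a state, move the head on the input tape, write
and move on the work tape and on the link traversal tape, and possibly append a symbol to the
output. -/
structure Action (State Γ : Type) where
  next : State
  inputMove : Option Turing.Dir
  workWrite : Cell Γ
  workMove : Option Turing.Dir
  linkWrite : Cell Γ
  linkMove : Option Turing.Dir
  out : Option Sym

/-- An LD machine: a finite program for a Turing machine with five tapes. The machine halts when the
transition function `δ` is undefined (`none`) for the current state and the symbols read on the
input tape, on the work tape and on the link traversal tape. -/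
structure LDMachine where
  State : Type
  finite_State : Finite State
  Γ : Type
  finite_Γ : Finite Γ
  start : State
  expand : State
  accepting : Set State
  rejecting : Set State
  disjoint_acc_rej : Disjoint accepting rejecting
  δ : State → Option Sym → Cell Γ → Cell Γ → Option (Action State Γ)

/-- A configuration of an LD machine (the Web tape never changes and is not part of it). -/
structure Cfg (M : LDMachine) where
  state : M.State
  input : Turing.Tape (Option Sym)
  work : Turing.Tape (Cell M.Γ)
  link : RTape (Sym ⊕ M.Γ)
  output : List Sym

/-- The suffix of `w` is the encoding of `u`: `w` ends in `enc(u)`, and this suffix is the whole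
block of binary digits at the end of `w`. -/
def EndsWithURI {Γ : Type} (w : List (Cell Γ)) (u : URI) : Prop :=
  ∃ l : List (Cell Γ), w = l ++ (encURI u).map (fun s => some (Sum.inl s)) ∧
    ∀ c ∈ l.getLast?, c ≠ some (Sum.inl Sym.zero) ∧ c ≠ some (Sum.inl Sym.one)

open Classical in
/-- The word that the expand procedure appends to the word `w` on the link traversal tape if the Web
tape contains the encoding of `W`. -/
def expandText {Γ : Type} (W : Web) (w : List (Cell Γ)) : List Sym :=
  if h : ∃ d : W.D, ∃ u : URI, EndsWithURI w u ∧ W.adoc u = some d ∧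
      TapeContains (webTape W)
        ([.hash] ++ encURI u ++ encTriples (W.data d) ++ [.hash]) then
    encTriples (W.data h.choose) ++ [.hash]
  else [.hash]

open Classical in
/-- The expand procedure, which is performed exactly in the expand state. -/
def LDMachine.doExpand (M : LDMachine) (W : Web) (c : Cfg M) : Cfg M :=
  if c.state = M.expand then
    { c with link := c.link.append ((expandText W c.link.word).map Sum.inl) }
  else c

/-- An ordinary step of the machine. -/
def LDMachine.ordinaryStep (M : LDMachine) (c : Cfg M) : Option (Cfg M) :=
  (M.δ c.state c.input.head c.work.head c.link.read).map fun a =>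
    { state := a.next
      input := moveTape c.input a.inputMove
      work := moveTape (c.work.write a.workWrite) a.workMove
      link := (c.link.write a.linkWrite).move a.linkMove
      output := c.output ++ a.out.toList }

/-- One step of the machine with `W` encoded on its Web tape. -/
def LDMachine.step (M : LDMachine) (W : Web) (c : Cfg M) : Option (Cfg M) :=
  M.ordinaryStep (M.doExpand W c)

/-- The initial configuration for a word on the ordinary input tape. -/
def LDMachine.init (M : LDMachine) (x : List Sym) : Cfg M where
  state := M.start
  input := Turing.Tape.mk₁ (x.map some)
  work := Turing.Tape.mk₁ []
  link := RTape.blank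
  output := []

/-- The configuration `c` occurs in the computation of `M` on the Web `W` and the input `x`. -/
def LDMachine.Visits (M : LDMachine) (W : Web) (x : List Sym) (c : Cfg M) : Prop :=
  StateTransition.Reaches (M.step W) (M.init x) c

/-- The computation of `M` on the Web `W` and the input `x` halts, with final configuration `c`. -/
def LDMachine.HaltsWith (M : LDMachine) (W : Web) (x : List Sym) (c : Cfg M) : Prop :=
  M.Visits W x c ∧ M.step W c = none

/-! ## Decidability and computability by LD machines -/

/-- The decision problem for `DP ⊆ 𝒲 × X` is LD machine decidable, where `enc` encodes the
elements of `X`. -/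
def LDMachineDecidable (𝒲 : Set Web) {X : Type} (enc : X → List Sym)
    (DP : Web → X → Prop) : Prop :=
  ∃ M : LDMachine, ∀ W ∈ 𝒲, ∀ x : X,
    (DP W x → ∃ c, M.HaltsWith W (enc x) c ∧ c.state ∈ M.accepting) ∧
    (¬ DP W x → ∃ c, M.HaltsWith W (enc x) c ∧ c.state ∈ M.rejecting)

/-- With `W` on its Web tape (and empty input), `M` halts with an encoding of `q(W)` on its output
tape. -/
def LDMachine.HaltsWithResult (M : LDMachine) (q : LDQuery) (W : Web) : Prop :=
  ∃ c, M.HaltsWith W [] c ∧ IsEncoding (q W) c.output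

/-- `M` eventually computes the Linked Data query `q`. -/
def LDMachine.EventuallyComputes (M : LDMachine) (q : LDQuery) : Prop :=
  ∀ W : Web,
    (∀ c, M.Visits W [] c → IsInitialOfEncoding (q W) c.output) ∧
    (∀ μ ∈ q W, ∃ c, M.Visits W [] c ∧ encVal μ <:+: c.output)

/-- The satisfiable SPARQL queries under full-Web semantics, given by SPARQL expressions. -/
def SatQuery : Type := {P : Expr // LDQuery.Satisfiable (fullWebQuery P)}

def encSatQuery (Q : SatQuery) : List Sym := encExpr Q.1

/-- The termination problem, with `computes the query result over W` understood for the Web `W`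
alone: some LD machine halts on `W` with (an encoding of) the query result over `W`. -/
def TerminationOn (W : Web) (Q : SatQuery) : Prop :=
  ∃ M : LDMachine, M.HaltsWithResult (fullWebQuery Q.1) W

/-- The termination problem, with `computes` understood for the query: some LD machine that
eventually computes the query (over every Web) halts on `W` with the query result over `W`. -/
def TerminationUniform (W : Web) (Q : SatQuery) : Prop :=
  ∃ M : LDMachine, M.EventuallyComputes (fullWebQuery Q.1) ∧
    M.HaltsWithResult (fullWebQuery Q.1) W

end

end LinkedData

namespace LinkedData

noncomputable section

/-! ## Encodings of URIs and triples -/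

/-! A halting computation sees only finitely many documents. A link traversal word of length `k` can
end in the encoding of a URI only if its index is below `2 ^ k`. So a halting run on the empty Web
is, step by step, also a run on every Web whose first `N` URIs have no document, for a suitable `N`.
A decider therefore cannot tell the empty Web from a Web whose documents are far out
(`LDMachineDecidable.exists_iff_emptyWeb`). It remains to find, for each reading, a query whose
answers on these Webs differ.

For `TerminationOn`, a machine may have a finite result built in, so the "no" instance needs an
infinite result. The pattern that matches every triple has no solution over the empty Web and
infinitely many over `bnodeWeb N`.

For `TerminationUniform`, the query is the variable-free pattern of the zero triple. A machine that
eventually computes it cannot halt on the empty Web with empty output, because the same halting run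
on `singletonWeb N` would miss the solution there. On `singletonWeb N` itself the answer is yes,
which requires an actual machine: `searcher` expands all URIs in turn until it meets the zero
triple. Most of the proof verifies this machine. -/

theorem mem_encNat {s : Sym} {n : ℕ} (h : s ∈ encNat n) : s = .zero ∨ s = .one := by
  obtain ⟨b, -, rfl⟩ := List.mem_map.1 h
  cases b <;> simp [bitSym]

/-- The most significant bit of a nonzero number is one, and `0` is encoded by the empty word. -/
theorem one_mem_encNat {n : ℕ} : Sym.one ∈ encNat n ↔ n ≠ 0 := by
  induction n using Nat.binaryRec' with
  | zero => simp [encNat]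
  | bit b n h ih =>
    simp only [encNat, Nat.bits_append_bit n b h, List.map_cons, List.mem_cons]
    cases b
    · have hn : n ≠ 0 := fun h0 => by simpa using h h0
      have := ih.2 hn
      simp only [encNat] at this
      simp [this, Nat.bit, hn]
    · simp [bitSym, Nat.bit]

theorem encNat_injective : Function.Injective encNat := by
  intro m n h
  have hb : Function.Injective bitSym := by
    intro a b; cases a <;> cases b <;> simp [bitSym]
  have h' : m.bits = n.bits := List.map_injective_iff.2 hb h
  induction m using Nat.binaryRec' generalizing n with
  | zero =>
    by_contra hn
    have := one_mem_encNat.2 (Ne.symm hn)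
    rw [← h] at this
    simp [encNat] at this
  | bit b m hm ih =>
    induction n using Nat.binaryRec' with
    | zero => simp [Nat.bits_append_bit m b hm] at h'
    | bit c n hn _ =>
      rw [Nat.bits_append_bit m b hm, Nat.bits_append_bit n c hn, List.cons.injEq] at h'
      rw [h'.1, ih (by simp [encNat, h'.2]) h'.2]

theorem mem_encURI {s : Sym} {u : URI} (h : s ∈ encURI u) : s = .zero ∨ s = .one := by
  simp only [encURI, List.mem_cons] at h
  rcases h with h | h | h
  · exact .inl h
  · exact .inl h
  · exact mem_encNat h

theorem encURI_injective : Function.Injective encURI := by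
  rintro ⟨m⟩ ⟨n⟩ h
  simp only [encURI, List.cons.injEq, true_and] at h
  rw [encNat_injective h]

theorem idx_lt_of_length_encURI_le {u : URI} {k : ℕ} (h : (encURI u).length ≤ k) :
    u.idx < 2 ^ k := by
  have h1 : u.idx.size ≤ k := by
    rw [← Nat.size_eq_bits_len]
    simp only [encURI, encNat, List.length_cons, List.length_map] at h
    omega
  exact Nat.size_le.1 h1

theorem mem_encTerm {s : Sym} {t : Term} (h : s ∈ encTerm t) : s = .zero ∨ s = .one := by
  cases t <;> simp only [encTerm, encURI, encBNode, encLit, List.mem_cons] at h <;>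
    rcases h with h | h | h <;> first | exact mem_encNat h | simp [h]

/-- The two kind bits contain a one for blank nodes and literals but not for URIs. -/
theorem one_mem_encTerm {t : Term} : Sym.one ∈ encTerm t ↔ t ≠ .uri ⟨0⟩ := by
  rcases t with ⟨⟨u⟩⟩ | ⟨b⟩ | ⟨c⟩ <;>
    simp [encTerm, encURI, encBNode, encLit, one_mem_encNat]

/-- The triple all of whose components are the first URI. -/
def zeroTriple : Triple := ⟨.uri ⟨0⟩, ⟨0⟩, .uri ⟨0⟩⟩

/-- The encoding of a triple without its angle brackets. -/
def encTripleBody (t : Triple) : List Sym :=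
  encTerm t.s.toTerm ++ [.comma] ++ encURI t.p ++ [.comma] ++ encTerm t.o

theorem encTriple_eq (t : Triple) : encTriple t = .langle :: (encTripleBody t ++ [.rangle]) := by
  simp [encTriple, encTripleBody]

theorem mem_encTripleBody {s : Sym} {t : Triple} (h : s ∈ encTripleBody t) :
    s = .zero ∨ s = .one ∨ s = .comma := by
  simp only [encTripleBody, List.mem_append, List.mem_singleton] at h
  rcases h with (((h | h) | h) | h) | h
  · have := mem_encTerm h; tauto
  · tauto
  · have := mem_encURI h; tauto
  · tauto
  · have := mem_encTerm h; tauto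

/-- This makes the zero triple recognizable with one bit of memory, without comparing words. -/
theorem one_mem_encTripleBody {t : Triple} : Sym.one ∈ encTripleBody t ↔ t ≠ zeroTriple := by
  obtain ⟨s, ⟨p⟩, o⟩ := t
  have hs : s.toTerm = .uri ⟨0⟩ ↔ s = .uri ⟨0⟩ := by
    cases s <;> simp [Subj.toTerm]
  simp [encTripleBody, zeroTriple, one_mem_encTerm, encURI, one_mem_encNat, hs]
  tauto

theorem encTriples_eq (T : Finset Triple) :
    encTriples T = .llangle :: (List.intercalate [.comma] (T.sort.map encTriple) ++ [.rrangle]) := by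
  simp [encTriples]

theorem mem_intercalate_comma {s : Sym} {L : List (List Sym)}
    (h : s ∈ List.intercalate [.comma] L) : s = .comma ∨ ∃ l ∈ L, s ∈ l := by
  induction L with
  | nil => simp at h
  | cons a L ih =>
    cases L with
    | nil => simp at h; exact .inr ⟨a, by simp, h⟩
    | cons b L =>
      rw [List.intercalate_cons_cons] at h
      simp only [List.mem_append, List.mem_singleton] at h
      rcases h with (h | h) | h
      · exact .inr ⟨a, by simp, h⟩
      · exact .inl h
      · rcases ih h with h | ⟨l, hl, h⟩
        · exact .inl h
        · exact .inr ⟨l, List.mem_cons_of_mem _ hl, h⟩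

theorem hash_notMem_encTriples (T : Finset Triple) : Sym.hash ∉ encTriples T := by
  intro h
  simp only [encTriples_eq, List.mem_cons, List.mem_append, reduceCtorEq, false_or,
    List.not_mem_nil, or_false] at h
  rcases mem_intercalate_comma h with h | ⟨l, hl, h⟩
  · cases h
  · obtain ⟨t, -, rfl⟩ := List.mem_map.1 hl
    simp only [encTriple_eq, List.mem_cons, List.mem_append, reduceCtorEq, false_or,
      List.not_mem_nil, or_false] at h
    rcases mem_encTripleBody h with h | h | h <;> cases h

/-! ## Searching a text for the encoding of the zero triple -/

/-- One pass over a text that looks for an encoded triple without the digit `one`; the flag says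
whether no such digit occurred since the last opening bracket. The value `none` is returned as soon
as the search succeeds. -/
def scanRun : Bool → List Sym → Option Bool
  | b, [] => some b
  | _, .langle :: l => scanRun true l
  | _, .one :: l => scanRun false l
  | true, .rangle :: _ => none
  | false, .rangle :: l => scanRun false l
  | b, _ :: l => scanRun b l

theorem scanRun_append (b : Bool) (l l' : List Sym) :
    scanRun b (l ++ l') = (scanRun b l).bind fun b' => scanRun b' l' := by
  fun_induction scanRun b l <;> simp_all [scanRun]

open Classical in
theorem scanRun_of_noBrackets (b : Bool) (l : List Sym)
    (h : ∀ s ∈ l, s = .zero ∨ s = .one ∨ s = .comma) :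
    scanRun b l = some (b && !decide (Sym.one ∈ l)) := by
  induction l generalizing b with
  | nil => simp [scanRun]
  | cons s l ih =>
    have hl := fun b => ih b fun s hs => h s (List.mem_cons_of_mem _ hs)
    rcases h s (by simp) with rfl | rfl | rfl <;> simp [scanRun, hl]

open Classical in
-- The opening bracket resets the flag, so the outcome does not depend on `b`; at the closing
-- bracket the flag says whether a one was met.
theorem scanRun_encTriple (b : Bool) (t : Triple) :
    (t = zeroTriple ∧ scanRun b (encTriple t) = none) ∨
      (t ≠ zeroTriple ∧ scanRun b (encTriple t) = some false) := by
  have h : scanRun b (encTriple t) =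
      (some (!decide (Sym.one ∈ encTripleBody t))).bind fun b' => scanRun b' [.rangle] := by
    rw [encTriple_eq, scanRun, scanRun_append,
      scanRun_of_noBrackets _ _ fun s => mem_encTripleBody, Bool.true_and]
  by_cases ht : t = zeroTriple
  · refine .inl ⟨ht, ?_⟩
    have h1 : Sym.one ∉ encTripleBody t := by simp [one_mem_encTripleBody, ht]
    simp [h, h1, scanRun]
  · refine .inr ⟨ht, ?_⟩
    have h1 : Sym.one ∈ encTripleBody t := one_mem_encTripleBody.2 ht
    simp [h, h1, scanRun]

theorem scanRun_intercalate (b : Bool) (L : List Triple) :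
    scanRun b (List.intercalate [.comma] (L.map encTriple)) = none ↔ zeroTriple ∈ L := by
  induction L generalizing b with
  | nil => simp [scanRun]
  | cons t L ih =>
    cases L with
    | nil =>
      rcases scanRun_encTriple b t with ⟨h, h'⟩ | ⟨h, h'⟩
      · simp [h', ← h]
      · simp [h', Ne.symm h]
    | cons t' L =>
      simp only [List.map_cons] at ih ⊢
      rw [List.intercalate_cons_cons, List.append_assoc, scanRun_append, List.mem_cons]
      rcases scanRun_encTriple b t with ⟨h, h'⟩ | ⟨h, h'⟩
      · simp [h', ← h]
      · simp only [h', Option.bind_some, List.cons_append, List.nil_append, scanRun, ih]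
        simp [Ne.symm h]

theorem scanRun_encTriples (b : Bool) (T : Finset Triple) :
    scanRun b (encTriples T) = none ↔ zeroTriple ∈ T := by
  have h : ∀ o : Option Bool, (o.bind fun b' => scanRun b' [.rrangle]) = none ↔ o = none := by
    rintro (_ | _ | _) <;> simp [scanRun]
  rw [encTriples_eq, scanRun, scanRun_append, h, scanRun_intercalate, Finset.mem_sort]
  all_goals simp

/-! ## The expand procedure -/

theorem EndsWithURI.length_le {Γ : Type} {w : List (Cell Γ)} {u : URI} (h : EndsWithURI w u) :
    (encURI u).length ≤ w.length := by
  obtain ⟨l, rfl, -⟩ := h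
  simp

/-- The encoded URI is the maximal block of digits at the end of `w`, and such a block is unique. -/
theorem EndsWithURI.unique {Γ : Type} {w : List (Cell Γ)} {u v : URI} (hu : EndsWithURI w u)
    (hv : EndsWithURI w v) : u = v := by
  let f : Sym → Cell Γ := fun s => some (Sum.inl s)
  have hf : Function.Injective f := fun a b h => by simpa [f] using h
  -- If two decompositions of `w` differ by a nonempty `a`, the last cell of the longer `l` is a
  -- digit of the other URI, which maximality forbids.
  have key : ∀ {l l' a : List (Cell Γ)} {u : URI}, l = l' ++ a → (∀ c ∈ l.getLast?,
      c ≠ some (Sum.inl Sym.zero) ∧ c ≠ some (Sum.inl Sym.one)) → a <+: (encURI u).map f →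
      a = [] := by
    intro l l' a u hl hc ha
    by_contra hne
    have hm := hc (a.getLast hne) (by simp [hl, List.getLast?_append, List.getLast?_eq_some_getLast hne])
    obtain ⟨s, hs, hs'⟩ := List.mem_map.1 (ha.subset (List.getLast_mem hne))
    rcases mem_encURI hs with rfl | rfl
    · exact hm.1 hs'.symm
    · exact hm.2 hs'.symm
  obtain ⟨l, h1, hl⟩ := hu
  obtain ⟨l', h1', hl'⟩ := hv
  rw [h1] at h1'
  apply encURI_injective
  apply List.map_injective_iff.2 hf
  rcases List.append_eq_append_iff.1 h1' with ⟨a, ha, ha'⟩ | ⟨a, ha, ha'⟩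
  · have := key (u := u) ha hl' (ha' ▸ List.prefix_append _ _)
    simpa [this] using ha'
  · have := key (u := v) ha hl (ha' ▸ List.prefix_append _ _)
    simpa [this] using ha'.symm

theorem webInitial_succ (W : Web) (n : ℕ) : webInitial W (n + 1) = webInitial W n ++ webRecord W n := by
  simp [webInitial, List.range_succ]

theorem webInitial_prefix (W : Web) {m n : ℕ} (h : m ≤ n) : webInitial W m <+: webInitial W n := by
  induction n, h using Nat.le_induction with
  | base => exact List.prefix_refl _
  | succ n _ ih => exact ih.trans (webInitial_succ W n ▸ List.prefix_append _ _)

theorem webTape_eq {W : Web} {n k : ℕ} (h : k < (webInitial W n).length) :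
    webTape W k = (webInitial W n)[k]? := by
  have hex : ∃ n, k < (webInitial W n).length := ⟨n, h⟩
  rw [webTape, dif_pos hex]
  obtain ⟨r, hr⟩ := webInitial_prefix W (Nat.find_le h : Nat.find hex ≤ n)
  rw [← hr, List.getElem?_append_left (Nat.find_spec hex)]

/-- The record starts where the records of all smaller indices end. Hence the lookup on the Web tape
always succeeds when `adoc` is defined. -/
theorem tapeContains_webRecord {W : Web} {u : URI} {d : W.D} (h : W.adoc u = some d) :
    TapeContains (webTape W) ([.hash] ++ encURI u ++ encTriples (W.data d) ++ [.hash]) := by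
  have hr : webRecord W u.idx = [.hash] ++ encURI u ++ encTriples (W.data d) ++ [.hash] := by
    simp [webRecord, h]
  refine ⟨(webInitial W u.idx).length, fun i hi => ?_⟩
  rw [webTape_eq (n := u.idx + 1), webInitial_succ, hr] <;>
    simp only [webInitial_succ, hr, List.length_append] at hi ⊢
  · rw [List.getElem?_append_right (by omega), Nat.add_sub_cancel_left, List.getElem?_eq_getElem]
  · omega

/-- The document that `W` assigns to `u` is defined and contains the zero triple. -/
def HasZeroAt (W : Web) (u : URI) : Prop := ∃ d, W.adoc u = some d ∧ zeroTriple ∈ W.data d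

theorem zeroTriple_mem_allData {W : Web} : zeroTriple ∈ W.allData ↔ ∃ n, HasZeroAt W ⟨n⟩ := by
  constructor
  · rintro ⟨d, hd⟩
    obtain ⟨u, hu⟩ := W.adoc_surj d
    exact ⟨u.idx, d, hu, hd⟩
  · rintro ⟨n, d, -, hd⟩
    exact ⟨d, hd⟩

/-- All that the search machine needs to know about expansion: the appended text has its only hash
at the end, and scanning it decides whether the document contains the zero triple. -/
theorem expandText_spec {Γ : Type} (W : Web) {w : List (Cell Γ)} {u : URI} (hw : EndsWithURI w u) :
    ∃ t, expandText W w = t ++ [.hash] ∧ .hash ∉ t ∧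
      ∀ b, scanRun b t = none ↔ HasZeroAt W u := by
  by_cases h : ∃ d : W.D, ∃ u : URI, EndsWithURI w u ∧ W.adoc u = some d ∧
      TapeContains (webTape W) ([.hash] ++ encURI u ++ encTriples (W.data d) ++ [.hash])
  · refine ⟨encTriples (W.data h.choose), by rw [expandText, dif_pos h], hash_notMem_encTriples _,
      fun b => ?_⟩
    obtain ⟨v, hv, hd, -⟩ := h.choose_spec
    rw [scanRun_encTriples]
    constructor
    · exact fun hz => ⟨_, hw.unique hv ▸ hd, hz⟩
    · rintro ⟨d, hd', hz⟩
      rw [hw.unique hv, hd] at hd'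
      cases hd'
      exact hz
  -- Without a document the text before the hash is empty, and the scan of it does not succeed.
  · refine ⟨[], by rw [expandText, dif_neg h]; rfl, by simp, fun b => ?_⟩
    simp only [scanRun, reduceCtorEq, false_iff]
    rintro ⟨d, hd, -⟩
    exact h ⟨d, u, hw, hd, tapeContains_webRecord hd⟩

/-! ## Finite computations depend on finitely many documents only -/

theorem expandText_eq_hash {Γ : Type} {W : Web} {w : List (Cell Γ)}
    (h : ∀ n < 2 ^ w.length, W.adoc ⟨n⟩ = none) : expandText W w = [.hash] := by
  rw [expandText, dif_neg]
  rintro ⟨d, u, hu, hd, -⟩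
  rw [show u = ⟨u.idx⟩ from rfl, h _ (idx_lt_of_length_encURI_le hu.length_le)] at hd
  cases hd

/-- A step depends on the Web only through `expandText`, which here is a single hash for both Webs.
-/
theorem step_congr {M : LDMachine} {W W' : Web} {c : Cfg M}
    (h : ∀ n < 2 ^ c.link.word.length, W.adoc ⟨n⟩ = none)
    (h' : ∀ n < 2 ^ c.link.word.length, W'.adoc ⟨n⟩ = none) : M.step W c = M.step W' c := by
  simp only [LDMachine.step, LDMachine.doExpand, expandText_eq_hash h, expandText_eq_hash h']

/-- The Web without documents. -/
def emptyWeb : Web where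
  D := Empty
  countable_D := inferInstance
  data := fun d => d.elim
  data_bnodes := fun d => d.elim
  adoc := fun _ => none
  adoc_surj := fun d => d.elim

theorem allData_emptyWeb : emptyWeb.allData = ∅ :=
  Set.eq_empty_of_forall_notMem fun _ ⟨d, _⟩ => d.elim

theorem exists_visits_of_emptyWeb {M : LDMachine} {x : List Sym} {c : Cfg M}
    (h : M.Visits emptyWeb x c) :
    ∃ N, ∀ W : Web, (∀ n < N, W.adoc ⟨n⟩ = none) → M.Visits W x c := by
  induction h with
  | refl => exact ⟨0, fun _ _ => .refl⟩
  | @tail b c _ hbc ih =>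
    obtain ⟨N, hN⟩ := ih
    -- The bound must exceed every index that the link word at the step out of `b` can name.
    refine ⟨max N (2 ^ b.link.word.length), fun W hW => ?_⟩
    refine (hN W fun n hn => hW n (lt_max_of_lt_left hn)).tail ?_
    rwa [step_congr (W' := emptyWeb) (fun n hn => hW n (lt_max_of_lt_right hn)) fun _ _ => rfl]

theorem exists_haltsWith_of_emptyWeb {M : LDMachine} {x : List Sym} {c : Cfg M}
    (h : M.HaltsWith emptyWeb x c) :
    ∃ N, ∀ W : Web, (∀ n < N, W.adoc ⟨n⟩ = none) → M.HaltsWith W x c := by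
  obtain ⟨N, hN⟩ := exists_visits_of_emptyWeb h.1
  -- Halting is tested after a possible expansion, so the final configuration contributes to the
  -- bound too.
  refine ⟨max N (2 ^ c.link.word.length), fun W hW => ?_⟩
  refine ⟨hN W fun n hn => hW n (lt_max_of_lt_left hn), ?_⟩
  rw [step_congr (W' := emptyWeb) (fun n hn => hW n (lt_max_of_lt_right hn)) fun _ _ => rfl]
  exact h.2

/-! ### Determinism of computations and monotonicity of the output -/

theorem LDMachine.HaltsWith.reaches {M : LDMachine} {W : Web} {x : List Sym} {c b : Cfg M}
    (hc : M.HaltsWith W x c) (hb : M.Visits W x b) : StateTransition.Reaches (M.step W) b c := by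
  rcases StateTransition.reaches_total hc.1 hb with h | h
  · rcases Relation.ReflTransGen.cases_head h with rfl | ⟨d, hd, -⟩
    · exact .refl
    · rw [hc.2] at hd
      cases hd
  · exact h

theorem LDMachine.HaltsWith.unique {M : LDMachine} {W : Web} {x : List Sym} {c c' : Cfg M}
    (hc : M.HaltsWith W x c) (hc' : M.HaltsWith W x c') : c = c' := by
  rcases Relation.ReflTransGen.cases_head (hc.reaches hc'.1) with h | ⟨d, hd, -⟩
  · exact h.symm
  · rw [hc'.2] at hd
    cases hd

theorem output_prefix_of_step {M : LDMachine} {W : Web} {b c : Cfg M} (h : c ∈ M.step W b) :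
    b.output <+: c.output := by
  simp only [LDMachine.step, LDMachine.ordinaryStep, Option.mem_def, Option.map_eq_some_iff] at h
  obtain ⟨a, -, rfl⟩ := h
  simp only [LDMachine.doExpand]
  split_ifs <;> exact List.prefix_append _ _

theorem output_prefix_of_reaches {M : LDMachine} {W : Web} {b c : Cfg M}
    (h : StateTransition.Reaches (M.step W) b c) : b.output <+: c.output := by
  induction h with
  | refl => exact List.prefix_refl _
  | tail _ h ih => exact ih.trans (output_prefix_of_step h)

/-- A decider gives the same answer for the empty Web and for every Web whose documents are all
assigned to URIs that are sufficiently large. -/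
theorem LDMachineDecidable.exists_iff_emptyWeb {X : Type} {enc : X → List Sym}
    {DP : Web → X → Prop} (h : LDMachineDecidable Set.univ enc DP) (x : X) :
    ∃ N, ∀ W : Web, (∀ n < N, W.adoc ⟨n⟩ = none) → (DP W x ↔ DP emptyWeb x) := by
  obtain ⟨M, hM⟩ := h
  by_cases h0 : DP emptyWeb x
  · obtain ⟨c, hc, hacc⟩ := (hM emptyWeb trivial x).1 h0
    obtain ⟨N, hN⟩ := exists_haltsWith_of_emptyWeb hc
    refine ⟨N, fun W hW => iff_of_true (by_contra fun hn => ?_) h0⟩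
    obtain ⟨c', hc', hrej⟩ := (hM W trivial x).2 hn
    -- By determinism the rejecting final configuration is the accepting one carried over from the
    -- empty Web.
    rw [hc'.unique (hN W hW)] at hrej
    exact Set.disjoint_left.1 M.disjoint_acc_rej hacc hrej
  · obtain ⟨c, hc, hrej⟩ := (hM emptyWeb trivial x).2 h0
    obtain ⟨N, hN⟩ := exists_haltsWith_of_emptyWeb hc
    refine ⟨N, fun W hW => iff_of_false (fun hy => ?_) h0⟩
    obtain ⟨c', hc', hacc⟩ := (hM W trivial x).1 hy
    rw [hc'.unique (hN W hW)] at hacc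
    exact Set.disjoint_left.1 M.disjoint_acc_rej hacc hrej

/-! ## Termination over a single Web -/

/-- The Web whose documents each contain one triple, with a blank node of their own, and where the
first `N` URIs have no document. -/
def bnodeWeb (N : ℕ) : Web where
  D := ℕ
  countable_D := inferInstance
  -- The blank node `d` serves twice: it separates the blank node sets of the documents and makes
  -- their triples distinct.
  data := fun d => {⟨.bnode ⟨d⟩, ⟨0⟩, .uri ⟨0⟩⟩}
  data_bnodes := by
    intro d₁ d₂ h
    have hb : ∀ d : ℕ, bnodesOf (({⟨.bnode ⟨d⟩, ⟨0⟩, .uri ⟨0⟩⟩} : Finset Triple) : Set Triple)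
        = {⟨d⟩} := by
      intro d
      ext ⟨b⟩
      simp [bnodesOf, Triple.terms, Subj.toTerm]
    rw [hb, hb]
    simpa using h
  adoc := fun u => if u.idx < N then none else some (u.idx - N)
  adoc_surj := fun d => ⟨⟨N + d⟩, by simp⟩

/-- The triple pattern that matches every triple. -/
def anyPattern : Expr := .triple ⟨.var ⟨0⟩, .var ⟨1⟩, .var ⟨2⟩⟩

/-- The solution of the pattern `anyPattern` for a triple. -/
def tripleVal (t : Triple) : Valuation := fun v =>
  match v.idx with
  | 0 => some t.s.toTerm
  | 1 => some (.uri t.p)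
  | 2 => some t.o
  | _ => none

theorem tripleVal_mem_eval {G : Set Triple} {t : Triple} (ht : t ∈ G) :
    tripleVal t ∈ anyPattern.eval G := by
  refine ⟨?_, t, ht, rfl, rfl, rfl⟩
  ext ⟨_ | _ | _ | n⟩ <;>
    simp [Valuation.dom, tripleVal, TriplePattern.vars, PatSP.vars, PatO.vars]

theorem infinite_anyPattern_bnodeWeb (N : ℕ) :
    (fullWebQuery anyPattern (bnodeWeb N)).Infinite := by
  refine Set.infinite_of_injective_forall_mem
    (f := fun d : ℕ => tripleVal ⟨.bnode ⟨d⟩, ⟨0⟩, .uri ⟨0⟩⟩) ?_ ?_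
  · intro a b h
    have := congrFun h ⟨0⟩
    simpa [tripleVal, Subj.toTerm] using this
  · exact fun d => tripleVal_mem_eval ⟨d, Finset.mem_singleton_self _⟩

theorem IsEncoding.finite {Ω : Set Valuation} {w : List Sym} (h : IsEncoding Ω w) : Ω.Finite := by
  obtain ⟨l, -, hl, -⟩ := h
  exact (List.finite_toSet l).subset fun μ hμ => (hl μ).2 hμ

theorem isEncoding_empty {w : List Sym} : IsEncoding ∅ w ↔ w = [] := by
  constructor
  · rintro ⟨l, -, hl, rfl⟩
    rw [List.eq_nil_iff_forall_not_mem.2 fun μ hμ => (hl μ).1 hμ]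
    rfl
  · rintro rfl
    exact ⟨[], by simp⟩

/-- The machine that halts at once. -/
def haltingMachine : LDMachine where
  State := Unit
  finite_State := inferInstance
  Γ := Empty
  finite_Γ := inferInstance
  start := ()
  expand := ()
  accepting := ∅
  rejecting := ∅
  disjoint_acc_rej := disjoint_bot_left
  δ := fun _ _ _ _ => none

theorem not_decidable_terminationOn : ¬ LDMachineDecidable Set.univ encSatQuery TerminationOn := by
  intro h
  let Q : SatQuery := ⟨anyPattern, bnodeWeb 0, (infinite_anyPattern_bnodeWeb 0).nonempty⟩
  obtain ⟨N, hN⟩ := h.exists_iff_emptyWeb Q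
  have hyes : TerminationOn emptyWeb Q := by
    -- The result over the empty Web is empty, and so is the output of a machine that halts in its
    -- initial configuration.
    refine ⟨haltingMachine, _, ⟨.refl, rfl⟩, ?_⟩
    have : fullWebQuery Q.1 emptyWeb = ∅ := by
      refine Set.eq_empty_of_forall_notMem ?_
      rintro μ ⟨-, t, ht, -⟩
      rw [allData_emptyWeb] at ht
      exact ht
    rw [this]
    exact isEncoding_empty.2 rfl
  obtain ⟨M, c, -, hc⟩ := (hN (bnodeWeb N) fun n hn => if_pos hn).2 hyes
  exact infinite_anyPattern_bnodeWeb N hc.finite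

/-! ## Tapes that hold a word -/

/-- The right-infinite tape with the word `w` at its left end. -/
def RTape.ofWord {α : Type} (w : List α) (h : ℕ) : RTape α := ⟨fun i => w[i]?, h⟩

namespace RTape

variable {α : Type}

theorem wordEnd_ofWord (w : List α) (h : ℕ) : (ofWord w h).wordEnd = w.length := by
  have : {n | ∀ m, n ≤ m → (ofWord w h).cells m = none} = Set.Ici w.length := by
    ext n
    simp only [ofWord, Set.mem_ofPred_eq, List.getElem?_eq_none_iff, Set.mem_Ici]
    exact ⟨fun hn => hn n le_rfl, fun hn m hm => hn.trans hm⟩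
  rw [wordEnd, this, csInf_Ici]

theorem word_ofWord (w : List α) (h : ℕ) : (ofWord w h).word = w.map some := by
  rw [word, wordEnd_ofWord]
  apply List.ext_getElem
  · simp
  · intro i h1 h2
    simp at h2
    simp [ofWord, h2]

/-- The head keeps its position: if it stood just behind `w`, it now stands at the start of `v`,
where the scan begins. -/
theorem append_ofWord (w v : List α) (h : ℕ) : (ofWord w h).append v = ofWord (w ++ v) h := by
  simp only [append, wordEnd_ofWord]
  simp only [ofWord, RTape.mk.injEq, and_true]
  funext i
  rw [List.getElem?_append]

theorem read_ofWord (p : List α) (a : α) (q : List α) :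
    (ofWord (p ++ a :: q) p.length).read = some a := by
  simp [ofWord, read]

theorem write_read (T : RTape α) : T.write T.read = T := by
  simp [write, read]

theorem write_ofWord_end (w : List α) (a : α) :
    (ofWord w w.length).write (some a) = ofWord (w ++ [a]) w.length := by
  simp only [write, ofWord, RTape.mk.injEq, and_true]
  funext i
  rcases lt_trichotomy i w.length with h | rfl | h
  · simp [h.ne, List.getElem?_append_left h]
  · simp
  · simp [h.ne', h.le, h]

end RTape

/-- The work cell that holds a given symbol. -/
def symCell (s : Sym) : Cell Empty := some (.inl s)

theorem mk₂_move_right {α : Type} [Inhabited α] (a : α) (L R : List α) :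
    (Turing.Tape.mk₂ L (a :: R)).move .right = Turing.Tape.mk₂ (a :: L) R := by
  simp [Turing.Tape.mk₂]

theorem mk₂_move_left {α : Type} [Inhabited α] (a : α) (L R : List α) :
    (Turing.Tape.mk₂ (a :: L) R).move .left = Turing.Tape.mk₂ L (a :: R) := by
  simp [Turing.Tape.mk₂]

theorem mk₂_write {α : Type} [Inhabited α] (a b : α) (L R : List α) :
    (Turing.Tape.mk₂ L (a :: R)).write b = Turing.Tape.mk₂ L (b :: R) := by
  simp [Turing.Tape.mk₂]

theorem mk₂_head {α : Type} [Inhabited α] (a : α) (L R : List α) :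
    (Turing.Tape.mk₂ L (a :: R)).head = a := by
  simp [Turing.Tape.mk₂]

/-- Half-tapes are lists up to trailing blanks. An explicit blank provides the cell onto which the
head leaves the counter. -/
theorem mk₂_default_left {α : Type} [Inhabited α] (R : List α) :
    Turing.Tape.mk₂ [default] R = Turing.Tape.mk₂ [] R := by
  have : Turing.ListBlank.mk [default] = Turing.ListBlank.mk ([] : List α) :=
    Quotient.sound' (.inr ⟨1, rfl⟩)
  rw [Turing.Tape.mk₂, this, Turing.Tape.mk₂]

theorem mk₂_default_right {α : Type} [Inhabited α] (L : List α) :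
    Turing.Tape.mk₂ L [default] = Turing.Tape.mk₂ L [] := by
  have : Turing.ListBlank.mk [default] = Turing.ListBlank.mk ([] : List α) :=
    Quotient.sound' (.inr ⟨1, rfl⟩)
  rw [Turing.Tape.mk₂, this, Turing.Tape.mk₂]

/-! ## A machine that searches for the zero triple -/

/-- `scanNo` and `scanYes` store the flag of `scanRun`. The two output symbols need separate steps,
since a step outputs at most one symbol: one is written on entering `found`, the other on entering
`done`. -/
inductive SearchState where
  | kind₁ | kind₂ | carry | copy | rewind | expand | scanNo | scanYes | found | done

instance : Finite SearchState := by
  let f : SearchState → Fin 10 := fun x => ⟨x.ctorIdx, by cases x <;> decide⟩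
  refine Finite.of_injective f ?_
  intro x y h
  cases x <;> cases y <;> first | rfl | (exact absurd h (by decide))

/-- The state of a pass over a text, with the given flag. -/
def SearchState.scan : Bool → SearchState
  | false => scanNo
  | true => scanYes

open SearchState in
/-- The transition function of the search machine. The work tape holds a binary counter. A round
copies the value of the counter to the link traversal tape (`kind₁`, `kind₂`, `carry` and `copy`),
increments the counter (`carry`), moves back to its first digit (`rewind`), and then scans the text
that the expand procedure provides. -/
def searchStep (q : SearchState) (w l : Cell Empty) : Option (Action SearchState Empty) :=
  let scanStep (b : Bool) : Option (Action SearchState Empty) :=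
    match l with
    | some (.inl .hash) => some ⟨kind₁, none, w, none, l, some .right, none⟩
    | some (.inl .langle) => some ⟨scanYes, none, w, none, l, some .right, none⟩
    | some (.inl .one) => some ⟨scanNo, none, w, none, l, some .right, none⟩
    | some (.inl .rangle) =>
      if b then some ⟨found, none, w, none, l, some .right, some .llangle⟩
      else some ⟨scanNo, none, w, none, l, some .right, none⟩
    | _ => some ⟨scan b, none, w, none, l, some .right, none⟩
  match q with
  | kind₁ => some ⟨kind₂, none, w, none, symCell .zero, some .right, none⟩
  | kind₂ => some ⟨carry, none, w, none, symCell .zero, some .right, none⟩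
  -- The old digit goes to the link tape while the incremented digit replaces it on the work tape. A
  -- zero absorbs the carry; a blank means that all digits were ones, and the counter gets a new
  -- leading digit that is not copied.
  | carry =>
    match w with
    | some (.inl .one) =>
      some ⟨carry, none, symCell .zero, some .right, symCell .one, some .right, none⟩
    | some _ => some ⟨copy, none, symCell .one, some .right, symCell .zero, some .right, none⟩
    | none => some ⟨rewind, none, symCell .one, some .left, l, none, none⟩
  | copy =>
    match w with
    | some s => some ⟨copy, none, w, some .right, some s, some .right, none⟩
    | none => some ⟨rewind, none, w, some .left, l, none, none⟩
  | rewind =>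
    match w with
    | some _ => some ⟨rewind, none, w, some .left, l, none, none⟩
    | none => some ⟨expand, none, w, some .right, l, none, none⟩
  | expand => some ⟨scanNo, none, w, none, l, none, none⟩
  | scanNo => scanStep false
  | scanYes => scanStep true
  | found => some ⟨done, none, w, none, l, none, some .rrangle⟩
  | done => none

/-- A machine that expands all URIs, one after the other, until it finds the zero triple. Then it
outputs the encoding of the empty valuation and halts. -/
abbrev searcher : LDMachine where
  State := SearchState
  finite_State := inferInstance
  Γ := Empty
  finite_Γ := inferInstance
  start := .kind₁
  expand := .expand
  accepting := ∅
  rejecting := ∅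
  disjoint_acc_rej := disjoint_bot_left
  δ := fun q _ w l => searchStep q w l

theorem searcher_step {W : Web} {q : SearchState} (hq : q ≠ .expand) (i : Turing.Tape (Option Sym))
    (w : Turing.Tape (Cell Empty)) (l : RTape (Sym ⊕ Empty)) (o : List Sym) :
    searcher.step W ⟨q, i, w, l, o⟩ = (searchStep q w.head l.read).map fun a =>
      ⟨a.next, moveTape i a.inputMove, moveTape (w.write a.workWrite) a.workMove,
        (l.write a.linkWrite).move a.linkMove, o ++ a.out.toList⟩ := by
  have h : searcher.doExpand W ⟨q, i, w, l, o⟩ = ⟨q, i, w, l, o⟩ := if_neg hq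
  rw [LDMachine.step, h]
  rfl

abbrev SReaches (W : Web) : Cfg searcher → Cfg searcher → Prop :=
  StateTransition.Reaches (searcher.step W)

/-- The tape contents for a list of symbols. -/
abbrev symWord (l : List Sym) : List (Sym ⊕ Empty) := l.map .inl

/-- Each machine step mirrors one clause of `scanRun`; a hash is excluded because it would end the
round. After success the link tape no longer matters, so it is left unspecified. -/
theorem searcher_scan {W : Web} {b : Bool} {t : List Sym} (ht : .hash ∉ t) (p q : List Sym)
    (i : Turing.Tape (Option Sym)) (w : Turing.Tape (Cell Empty)) (o : List Sym) :
    (∀ b', scanRun b t = some b' →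
      SReaches W ⟨.scan b, i, w, .ofWord (symWord (p ++ t ++ q)) p.length, o⟩
        ⟨.scan b', i, w, .ofWord (symWord (p ++ t ++ q)) (p ++ t).length, o⟩) ∧
    (scanRun b t = none → ∃ l,
      SReaches W ⟨.scan b, i, w, .ofWord (symWord (p ++ t ++ q)) p.length, o⟩
        ⟨.found, i, w, l, o ++ [.llangle]⟩) := by
  induction t generalizing b p with
  | nil =>
    refine ⟨fun b' h => ?_, fun h => by simp [scanRun] at h⟩
    simp only [scanRun, Option.some.injEq] at h
    subst h
    simp only [List.append_nil]
    exact .refl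
  | cons s t ih =>
    simp only [List.mem_cons, not_or] at ht
    have hr : (RTape.ofWord (symWord (p ++ s :: t ++ q)) p.length).read = symCell s := by
      have := RTape.read_ofWord (symWord p) (.inl s : Sym ⊕ Empty) (symWord (t ++ q))
      simpa [symWord, symCell] using this
    have hw : (RTape.ofWord (symWord (p ++ s :: t ++ q)) p.length).write (symCell s) =
        RTape.ofWord (symWord (p ++ s :: t ++ q)) p.length := by
      rw [← hr, RTape.write_read]
    have hstep : ∀ b', searchStep (.scan b) w.head (symCell s) =
          some ⟨.scan b', none, w.head, none, symCell s, some .right, none⟩ →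
        (⟨.scan b', i, w, .ofWord (symWord (p ++ s :: t ++ q)) (p.length + 1), o⟩ : Cfg searcher) ∈
          searcher.step W ⟨.scan b, i, w, .ofWord (symWord (p ++ s :: t ++ q)) p.length, o⟩ := by
      intro b' h
      rw [searcher_step (by cases b <;> simp [SearchState.scan]), hr, h]
      simp only [Option.map_some, moveTape, hw, Turing.Tape.write_self]
      simp [RTape.move, RTape.ofWord]
    -- This covers every symbol after which the scan goes on; only a closing bracket read with flag
    -- `true` is different.
    have main : ∀ b', searchStep (.scan b) w.head (symCell s) =
          some ⟨.scan b', none, w.head, none, symCell s, some .right, none⟩ →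
        scanRun b (s :: t) = scanRun b' t →
        (∀ b', scanRun b (s :: t) = some b' →
          SReaches W ⟨.scan b, i, w, .ofWord (symWord (p ++ s :: t ++ q)) p.length, o⟩
            ⟨.scan b', i, w, .ofWord (symWord (p ++ s :: t ++ q)) (p ++ s :: t).length, o⟩) ∧
        (scanRun b (s :: t) = none → ∃ l,
          SReaches W ⟨.scan b, i, w, .ofWord (symWord (p ++ s :: t ++ q)) p.length, o⟩
            ⟨.found, i, w, l, o ++ [.llangle]⟩) := by
      intro b' h1 h2
      have ih' := ih (b := b') ht.2 (p ++ [s])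
      simp only [List.append_assoc, List.length_append, List.length_cons, List.length_nil, zero_add,
        List.cons_append, List.nil_append] at ih' hstep ⊢
      rw [h2]
      refine ⟨fun b'' h => .head (hstep b' h1) ?_, fun h => ?_⟩
      · have := ih'.1 b'' h
        exact this
      · obtain ⟨l, hl⟩ := ih'.2 h
        exact ⟨l, .head (hstep b' h1) hl⟩
    by_cases hs : s = .rangle ∧ b = true
    · obtain ⟨rfl, rfl⟩ := hs
      refine ⟨fun b' h => by simp [scanRun] at h, fun _ => ?_⟩
      refine ⟨.ofWord (symWord (p ++ .rangle :: t ++ q)) (p.length + 1),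
        .single (Option.mem_def.2 ?_)⟩
      rw [searcher_step (by simp [SearchState.scan]), hr,
        show searchStep (.scan true) w.head (symCell .rangle) = some ⟨.found, none, w.head, none,
          symCell .rangle, some .right, some .llangle⟩ from rfl]
      simp only [Option.map_some, moveTape, hw, Turing.Tape.write_self]
      simp [RTape.move, RTape.ofWord]
    · cases s <;> cases b <;>
        first
        | exact absurd rfl ht.1
        | exact absurd ⟨rfl, rfl⟩ hs
        | exact main true rfl rfl
        | exact main false rfl rfl

/-- The successor of a number in binary representation. -/
def incBits : List Bool → List Bool
  | [] => [true]
  | false :: l => true :: l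
  | true :: l => false :: incBits l

theorem bits_succ (n : ℕ) : (n + 1).bits = incBits n.bits := by
  induction n using Nat.binaryRec' with
  | zero => simp [incBits]
  | bit b n h ih =>
    rw [Nat.bits_append_bit n b h]
    cases b
    · rw [incBits, ← Nat.bit1_bits, Nat.bit_false]
    · rw [incBits, ← ih, ← Nat.bit0_bits (n + 1) (by omega), Nat.bit_true]
      ring_nf

/-- The work tape contents for a list of bits. -/
def bitCells (l : List Bool) : List (Cell Empty) := l.map fun b => symCell (bitSym b)

theorem bitCells_nil : bitCells [] = [] := rfl

theorem bitCells_cons (b : Bool) (l : List Bool) :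
    bitCells (b :: l) = symCell (bitSym b) :: bitCells l := rfl

/-- The left half-tape lists the digits from the head outwards, hence `L.reverse`. Each step shifts
one digit to the right half, until the blank in front of the counter turns the head back. -/
theorem searcher_rewind {W : Web} (L R : List Bool) (i : Turing.Tape (Option Sym))
    (l : RTape (Sym ⊕ Empty)) (o : List Sym) :
    SReaches W ⟨.rewind, i, (Turing.Tape.mk₂ (bitCells L) (bitCells R)).move .left, l, o⟩
      ⟨.expand, i, Turing.Tape.mk₂ [] (bitCells (L.reverse ++ R)), l, o⟩ := by
  induction L generalizing R with
  | nil =>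
    refine .single (Option.mem_def.2 ?_)
    rw [searcher_step (by simp), bitCells_nil, ← mk₂_default_left, mk₂_move_left, mk₂_head,
      show searchStep .rewind default l.read =
        some ⟨.expand, none, default, some .right, l.read, none, none⟩ from rfl]
    simp only [Option.map_some, moveTape, mk₂_write, mk₂_move_right, RTape.write_read,
      mk₂_default_left]
    simp [RTape.move]
  | cons b L ih =>
    have := ih (b :: R)
    simp only [List.reverse_cons, List.append_assoc, List.singleton_append] at this ⊢
    refine .head (Option.mem_def.2 ?_) this
    rw [searcher_step (by simp), bitCells_cons, mk₂_move_left, mk₂_head,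
      show searchStep .rewind (symCell (bitSym b)) l.read =
        some ⟨.rewind, none, symCell (bitSym b), some .left, l.read, none, none⟩ from rfl]
    simp only [Option.map_some, moveTape, mk₂_write, RTape.write_read]
    simp [RTape.move, bitCells_cons]

theorem link_write_right (v : List Sym) (s : Sym) :
    ((RTape.ofWord (symWord v) v.length).write (symCell s)).move (some .right) =
      RTape.ofWord (symWord (v ++ [s])) (v ++ [s]).length := by
  have := RTape.write_ofWord_end (symWord v) (.inl s)
  simp only [symWord, List.length_map] at this
  rw [symCell, this]
  simp [RTape.move, RTape.ofWord]

theorem searcher_copy {W : Web} (L R : List Bool) (v : List Sym) (i : Turing.Tape (Option Sym))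
    (o : List Sym) :
    SReaches W ⟨.copy, i, Turing.Tape.mk₂ (bitCells L) (bitCells R),
        .ofWord (symWord v) v.length, o⟩
      ⟨.expand, i, Turing.Tape.mk₂ [] (bitCells (L.reverse ++ R)),
        .ofWord (symWord (v ++ R.map bitSym)) (v ++ R.map bitSym).length, o⟩ := by
  induction R generalizing L v with
  | nil =>
    have := searcher_rewind (W := W) L [] i (.ofWord (symWord v) v.length) o
    simp only [List.map_nil, List.append_nil] at this ⊢
    refine .head (Option.mem_def.2 ?_) this
    rw [searcher_step (by simp), bitCells_nil, ← mk₂_default_right, mk₂_head]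
    generalize RTape.ofWord (symWord v) v.length = l
    rw [show searchStep .copy default l.read =
        some ⟨.rewind, none, default, some .left, l.read, none, none⟩ from rfl]
    simp only [Option.map_some, moveTape, mk₂_write, RTape.write_read]
    simp [RTape.move]
  | cons b R ih =>
    have := ih (b :: L) (v ++ [bitSym b])
    simp only [List.reverse_cons, List.append_assoc, List.singleton_append] at this
    refine .head (Option.mem_def.2 ?_) this
    rw [searcher_step (by simp), bitCells_cons, mk₂_head,
      show ∀ c, searchStep .copy (symCell (bitSym b)) c = some ⟨.copy, none, symCell (bitSym b),
        some .right, symCell (bitSym b), some .right, none⟩ from fun _ => rfl]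
    simp only [Option.map_some, moveTape, mk₂_write, mk₂_move_right, link_write_right]
    simp [bitCells_cons]

/-- The induction follows `incBits` along the leading ones of `R`; the first zero hands over to
`searcher_copy`, the end of the counter to `searcher_rewind`. -/
theorem searcher_carry {W : Web} (L R : List Bool) (v : List Sym) (i : Turing.Tape (Option Sym))
    (o : List Sym) :
    SReaches W ⟨.carry, i, Turing.Tape.mk₂ (bitCells L) (bitCells R),
        .ofWord (symWord v) v.length, o⟩
      ⟨.expand, i, Turing.Tape.mk₂ [] (bitCells (L.reverse ++ incBits R)),
        .ofWord (symWord (v ++ R.map bitSym)) (v ++ R.map bitSym).length, o⟩ := by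
  induction R generalizing L v with
  | nil =>
    have := searcher_rewind (W := W) L [true] i (.ofWord (symWord v) v.length) o
    simp only [List.map_nil, List.append_nil] at this ⊢
    refine .head (Option.mem_def.2 ?_) this
    rw [searcher_step (by simp), bitCells_nil, ← mk₂_default_right, mk₂_head]
    generalize RTape.ofWord (symWord v) v.length = l
    rw [show searchStep .carry default l.read =
        some ⟨.rewind, none, symCell .one, some .left, l.read, none, none⟩ from rfl]
    simp only [Option.map_some, moveTape, mk₂_write, RTape.write_read]
    simp [RTape.move, bitCells_cons, bitCells_nil, bitSym]
  | cons b R ih =>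
    cases b
    · have := searcher_copy (W := W) (true :: L) R (v ++ [bitSym false]) i o
      simp only [List.reverse_cons, List.append_assoc, List.singleton_append] at this
      refine .head (Option.mem_def.2 ?_) this
      rw [searcher_step (by simp), bitCells_cons, mk₂_head,
        show ∀ c, searchStep .carry (symCell (bitSym false)) c = some ⟨.copy, none,
          symCell (bitSym true), some .right, symCell (bitSym false), some .right, none⟩
          from fun _ => rfl]
      simp only [Option.map_some, moveTape, mk₂_write, mk₂_move_right, link_write_right]
      simp [bitCells_cons]
    · have := ih (false :: L) (v ++ [bitSym true])
      simp only [List.reverse_cons, List.append_assoc, List.singleton_append] at this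
      refine .head (Option.mem_def.2 ?_) this
      rw [searcher_step (by simp), bitCells_cons, mk₂_head,
        show ∀ c, searchStep .carry (symCell (bitSym true)) c = some ⟨.carry, none,
          symCell (bitSym false), some .right, symCell (bitSym true), some .right, none⟩
          from fun _ => rfl]
      simp only [Option.map_some, moveTape, mk₂_write, mk₂_move_right, link_write_right]
      simp [bitCells_cons]

/-- The configurations at the start of the round for the URI with index `n`. -/
def RoundStart (n : ℕ) (c : Cfg searcher) : Prop :=
  ∃ (i : Turing.Tape (Option Sym)) (v : List Sym), (∀ s ∈ v.getLast?, s = .hash) ∧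
    c = ⟨.kind₁, i, Turing.Tape.mk₂ [] (bitCells n.bits), .ofWord (symWord v) v.length, []⟩

/-! ### One round of the search -/

theorem searcher_write_URI {W : Web} (n : ℕ) (v : List Sym) (i : Turing.Tape (Option Sym)) :
    StateTransition.Reaches₁ (searcher.step W)
      ⟨.kind₁, i, Turing.Tape.mk₂ [] (bitCells n.bits), .ofWord (symWord v) v.length, []⟩
      ⟨.expand, i, Turing.Tape.mk₂ [] (bitCells (n + 1).bits),
        .ofWord (symWord (v ++ encURI ⟨n⟩)) (v ++ encURI ⟨n⟩).length, []⟩ := by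
  have h := searcher_carry (W := W) [] n.bits (v ++ [.zero] ++ [.zero]) i []
  have e : v ++ [.zero] ++ [.zero] ++ n.bits.map bitSym = v ++ encURI ⟨n⟩ := by
    simp [encURI, encNat]
  rw [e, List.reverse_nil, List.nil_append, ← bits_succ] at h
  have h1 : (⟨.kind₂, i, Turing.Tape.mk₂ [] (bitCells n.bits),
      .ofWord (symWord (v ++ [.zero])) (v ++ [Sym.zero]).length, []⟩ : Cfg searcher) ∈
      searcher.step W ⟨.kind₁, i, Turing.Tape.mk₂ [] (bitCells n.bits),
        .ofWord (symWord v) v.length, []⟩ := by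
    rw [Option.mem_def, searcher_step (by simp)]
    simp only [searchStep, Option.map_some, moveTape, link_write_right, Turing.Tape.write_self]
    rfl
  refine .head' h1 (.head (Option.mem_def.2 ?_) h)
  rw [searcher_step (by simp)]
  simp only [searchStep, Option.map_some, moveTape, link_write_right, Turing.Tape.write_self]
  rfl

/-- The hash left by the previous round, or the left end of the tape in the first round, keeps
earlier digits out of the final block. -/
theorem endsWithURI_append {v : List Sym} (hv : ∀ s ∈ v.getLast?, s = .hash) (u : URI) :
    EndsWithURI ((symWord (v ++ encURI u)).map some) u := by
  refine ⟨(symWord v).map some, by simp, ?_⟩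
  intro c hc
  simp only [List.getLast?_map, Option.mem_def, Option.map_eq_some_iff] at hc
  obtain ⟨_, ⟨s, hs, rfl⟩, rfl⟩ := hc
  simp [hv s hs]

theorem searcher_expand {W : Web} {n : ℕ} {v : List Sym} (hv : ∀ s ∈ v.getLast?, s = .hash)
    (i : Turing.Tape (Option Sym)) (w : Turing.Tape (Cell Empty)) (o : List Sym) :
    ∃ t, .hash ∉ t ∧ (∀ b, scanRun b t = none ↔ HasZeroAt W ⟨n⟩) ∧
      SReaches W
        ⟨.expand, i, w, .ofWord (symWord (v ++ encURI ⟨n⟩)) (v ++ encURI ⟨n⟩).length, o⟩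
        ⟨.scan false, i, w, .ofWord (symWord (v ++ encURI ⟨n⟩ ++ t ++ [.hash]))
          (v ++ encURI ⟨n⟩).length, o⟩ := by
  obtain ⟨t, h1, h2, h3⟩ := expandText_spec W (endsWithURI_append hv ⟨n⟩)
  refine ⟨t, h2, h3, .single (Option.mem_def.2 ?_)⟩
  have h : searcher.doExpand W
      ⟨.expand, i, w, .ofWord (symWord (v ++ encURI ⟨n⟩)) (v ++ encURI ⟨n⟩).length, o⟩ =
      ⟨.expand, i, w, .ofWord (symWord (v ++ encURI ⟨n⟩ ++ t ++ [.hash]))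
          (v ++ encURI ⟨n⟩).length, o⟩ := by
    refine (if_pos rfl).trans ?_
    rw [RTape.word_ofWord, h1, RTape.append_ofWord]
    simp [symWord]
  rw [LDMachine.step, h]
  simp only [LDMachine.ordinaryStep, searcher, searchStep, Option.map_some, moveTape,
    Turing.Tape.write_self, RTape.write_read]
  simp [RTape.move, SearchState.scan]

/-- An unsuccessful scan runs into the closing hash, which starts the next round. That a round takes
at least one step matters in `searcher_output_eq_nil`. -/
theorem RoundStart.next {W : Web} {n : ℕ} {c : Cfg searcher} (hc : RoundStart n c)
    (hn : ¬ HasZeroAt W ⟨n⟩) :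
    ∃ c', RoundStart (n + 1) c' ∧ StateTransition.Reaches₁ (searcher.step W) c c' := by
  obtain ⟨i, v, hv, rfl⟩ := hc
  have h1 := searcher_write_URI (W := W) n v i
  obtain ⟨t, ht, hrun, h2⟩ := searcher_expand (W := W) (n := n) hv i
    (Turing.Tape.mk₂ [] (bitCells (n + 1).bits)) []
  obtain ⟨b, hb⟩ := Option.ne_none_iff_exists'.1 fun h => hn ((hrun false).1 h)
  have h3 := (searcher_scan (W := W) ht (v ++ encURI ⟨n⟩) [.hash] i
    (Turing.Tape.mk₂ [] (bitCells (n + 1).bits)) []).1 b hb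
  refine ⟨_, ⟨i, v ++ encURI ⟨n⟩ ++ t ++ [.hash], by simp, rfl⟩, h1.trans_left ((h2.trans h3).tail ?_)⟩
  set p := v ++ encURI ⟨n⟩ ++ t
  have hr : (RTape.ofWord (symWord (p ++ [.hash])) p.length).read = symCell .hash := by
    have := RTape.read_ofWord (symWord p) (.inl .hash : Sym ⊕ Empty) []
    simpa [symWord, symCell] using this
  have hw : (RTape.ofWord (symWord (p ++ [.hash])) p.length).write (symCell .hash) =
      RTape.ofWord (symWord (p ++ [.hash])) p.length := by
    rw [← hr, RTape.write_read]
  rw [Option.mem_def, searcher_step (by cases b <;> simp [SearchState.scan]), hr]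
  have hs : ∀ w, searchStep (.scan b) w (symCell .hash) =
      some ⟨.kind₁, none, w, none, symCell .hash, some .right, none⟩ := by
    intro w; cases b <;> rfl
  rw [hs]
  simp only [Option.map_some, moveTape, hw, Turing.Tape.write_self]
  simp [RTape.move, RTape.ofWord]

theorem RoundStart.halts {W : Web} {n : ℕ} {c : Cfg searcher} (hc : RoundStart n c)
    (hn : HasZeroAt W ⟨n⟩) :
    ∃ c', SReaches W c c' ∧ searcher.step W c' = none ∧ c'.output = [.llangle, .rrangle] := by
  obtain ⟨i, v, hv, rfl⟩ := hc
  have h1 := searcher_write_URI (W := W) n v i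
  obtain ⟨t, ht, hrun, h2⟩ := searcher_expand (W := W) (n := n) hv i
    (Turing.Tape.mk₂ [] (bitCells (n + 1).bits)) []
  obtain ⟨l, h3⟩ := (searcher_scan (W := W) ht (v ++ encURI ⟨n⟩) [.hash] i
    (Turing.Tape.mk₂ [] (bitCells (n + 1).bits)) []).2 ((hrun false).2 hn)
  refine ⟨⟨.done, i, Turing.Tape.mk₂ [] (bitCells (n + 1).bits), l, [.llangle, .rrangle]⟩,
    ((h1.to_reflTransGen.trans h2).trans h3).tail ?_, ?_, rfl⟩
  · rw [Option.mem_def, searcher_step (by simp)]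
    simp only [searchStep, Option.map_some, moveTape, Turing.Tape.write_self, RTape.write_read]
    rfl
  · rw [searcher_step (by simp)]
    rfl

theorem roundStart_init : RoundStart 0 (searcher.init []) :=
  ⟨Turing.Tape.mk₁ [], [], by simp, by
    simp only [LDMachine.init, List.map_nil, RTape.blank, RTape.ofWord]
    congr⟩

theorem searcher_halts {W : Web} (h : zeroTriple ∈ W.allData) :
    ∃ c, searcher.HaltsWith W [] c ∧ c.output = [.llangle, .rrangle] := by
  classical
  have hex := zeroTriple_mem_allData.1 h
  have hr : ∀ n ≤ Nat.find hex, ∃ c, RoundStart n c ∧ searcher.Visits W [] c := by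
    intro n hn
    induction n with
    | zero => exact ⟨_, roundStart_init, .refl⟩
    | succ n ih =>
      obtain ⟨c, hc, hv⟩ := ih (by omega)
      obtain ⟨c', hc', hv'⟩ := hc.next (Nat.find_min hex (by omega))
      exact ⟨c', hc', hv.trans hv'.to_reflTransGen⟩
  obtain ⟨c, hc, hv⟩ := hr _ le_rfl
  obtain ⟨c', h1, h2, h3⟩ := hc.halts (Nat.find_spec hex)
  exact ⟨c', ⟨hv.trans h1, h2⟩, h3⟩

/-- Every visited configuration is followed by the start of some round, where the output is empty;
since output only grows, it was empty before. -/
theorem searcher_output_eq_nil {W : Web} (h : zeroTriple ∉ W.allData) {c : Cfg searcher}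
    (hc : searcher.Visits W [] c) : c.output = [] := by
  have hn : ∀ n, ¬ HasZeroAt W ⟨n⟩ := fun n hn => h (zeroTriple_mem_allData.2 ⟨n, hn⟩)
  have key : ∃ n c', RoundStart n c' ∧ SReaches W c c' := by
    induction hc with
    | refl => exact ⟨0, _, roundStart_init, .refl⟩
    | tail _ hbc ih =>
      obtain ⟨n, c', hc', hr⟩ := ih
      obtain ⟨c'', hc'', hr'⟩ := hc'.next (hn n)
      -- A path of positive length to a later round start must, by determinism, pass through the
      -- given successor.
      exact ⟨n + 1, c'', hc'', StateTransition.reaches₁_fwd (hr'.trans_right hr) hbc⟩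
  obtain ⟨n, c', ⟨i, v, -, rfl⟩, hr⟩ := key
  exact List.prefix_nil.1 (output_prefix_of_reaches hr)

/-! ## Termination of machines that eventually compute the query -/

/-- The triple pattern without variables that matches the zero triple only. -/
def zeroPattern : Expr := .triple ⟨.uri ⟨0⟩, .uri ⟨0⟩, .uri ⟨0⟩⟩

def emptyVal : Valuation := fun _ => none

theorem dom_emptyVal : emptyVal.dom = ∅ := by
  simp [Valuation.dom, emptyVal]

theorem encVal_emptyVal : encVal emptyVal = [.llangle, .rrangle] := by
  simp [encVal, dom_emptyVal]

theorem mem_eval_zeroPattern {G : Set Triple} {μ : Valuation} :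
    μ ∈ zeroPattern.eval G ↔ μ = emptyVal ∧ zeroTriple ∈ G := by
  constructor
  · rintro ⟨hd, ⟨s, ⟨p⟩, o⟩, ht, h1, h2, h3⟩
    constructor
    · funext v
      have hv : v ∉ μ.dom := by
        rw [hd]
        simp [TriplePattern.vars, PatSP.vars, PatO.vars]
      simpa [Valuation.dom, emptyVal] using hv
    · simp only [PatSP.subst, PatO.subst, Option.some.injEq, Term.uri.injEq, URI.mk.injEq] at h1 h2 h3
      have hs : s = .uri ⟨0⟩ := Subj.toTerm_injective h1.symm
      subst hs h2 h3
      exact ht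
  · rintro ⟨rfl, h⟩
    refine ⟨?_, _, h, rfl, rfl, rfl⟩
    rw [dom_emptyVal]
    simp [TriplePattern.vars, PatSP.vars, PatO.vars]

theorem zeroPattern_of_mem {W : Web} (h : zeroTriple ∈ W.allData) :
    fullWebQuery zeroPattern W = {emptyVal} := by
  ext μ
  simp [fullWebQuery, mem_eval_zeroPattern, h]

theorem zeroPattern_of_notMem {W : Web} (h : zeroTriple ∉ W.allData) :
    fullWebQuery zeroPattern W = ∅ := by
  ext μ
  simp [fullWebQuery, mem_eval_zeroPattern, h]

theorem isEncoding_emptyVal : IsEncoding {emptyVal} [.llangle, .rrangle] :=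
  ⟨[emptyVal], by simp, by simp, by simp [encVal_emptyVal]⟩

/-- Without the zero triple the search goes on forever with empty output, which eventual computation
permits. -/
theorem searcher_eventuallyComputes : searcher.EventuallyComputes (fullWebQuery zeroPattern) := by
  intro W
  by_cases h : zeroTriple ∈ W.allData
  · obtain ⟨c, hc, ho⟩ := searcher_halts h
    rw [zeroPattern_of_mem h]
    refine ⟨fun b hb => .inl ⟨_, isEncoding_emptyVal, ?_⟩, ?_⟩
    · exact ho ▸ output_prefix_of_reaches (hc.reaches hb)
    · rintro μ rfl
      exact ⟨c, hc.1, by rw [ho, encVal_emptyVal]⟩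
  · rw [zeroPattern_of_notMem h]
    refine ⟨fun b hb => .inl ⟨[], isEncoding_empty.2 rfl, ?_⟩, fun μ hμ => hμ.elim⟩
    rw [searcher_output_eq_nil h hb]

/-- The Web with a single document, which contains the zero triple and is assigned to the URI with
index `N`. -/
def singletonWeb (N : ℕ) : Web where
  D := Unit
  countable_D := inferInstance
  data := fun _ => {zeroTriple}
  data_bnodes := fun _ _ h => absurd rfl h
  adoc := fun u => if u.idx = N then some () else none
  adoc_surj := fun _ => ⟨⟨N⟩, if_pos rfl⟩

theorem zeroTriple_mem_singletonWeb (N : ℕ) : zeroTriple ∈ (singletonWeb N).allData :=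
  ⟨(), Finset.mem_singleton_self _⟩

theorem singletonWeb_adoc {N n : ℕ} (h : n < N) : (singletonWeb N).adoc ⟨n⟩ = none :=
  if_neg h.ne

theorem not_terminationUniform_emptyWeb {Q : SatQuery} (hQ : Q.1 = zeroPattern) :
    ¬ TerminationUniform emptyWeb Q := by
  rintro ⟨M, hM, c, hc, ho⟩
  rw [hQ] at hM ho
  rw [zeroPattern_of_notMem (by simp [allData_emptyWeb]), isEncoding_empty] at ho
  -- The zero triple is placed at an index that this run cannot reach, so `M` halts with empty
  -- output although a solution exists.
  obtain ⟨N, hN⟩ := exists_haltsWith_of_emptyWeb hc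
  have hc' := hN (singletonWeb N) fun n => singletonWeb_adoc
  obtain ⟨b, hb, hi⟩ := (hM (singletonWeb N)).2 emptyVal
    (by simp [zeroPattern_of_mem (zeroTriple_mem_singletonWeb N)])
  have := output_prefix_of_reaches (hc'.reaches hb)
  rw [ho, List.prefix_nil] at this
  simp [this, encVal_emptyVal] at hi

theorem terminationUniform_singletonWeb {Q : SatQuery} (hQ : Q.1 = zeroPattern) (N : ℕ) :
    TerminationUniform (singletonWeb N) Q := by
  obtain ⟨c, hc, ho⟩ := searcher_halts (zeroTriple_mem_singletonWeb N)
  refine ⟨searcher, hQ ▸ searcher_eventuallyComputes, c, hc, ?_⟩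
  rw [hQ, ho, zeroPattern_of_mem (zeroTriple_mem_singletonWeb N)]
  exact isEncoding_emptyVal

theorem not_decidable_terminationUniform :
    ¬ LDMachineDecidable Set.univ encSatQuery TerminationUniform := by
  intro h
  let Q : SatQuery := ⟨zeroPattern, singletonWeb 0, by
    simp [zeroPattern_of_mem (zeroTriple_mem_singletonWeb 0)]⟩
  obtain ⟨N, hN⟩ := h.exists_iff_emptyWeb Q
  exact not_terminationUniform_emptyWeb rfl
    ((hN (singletonWeb N) fun n => singletonWeb_adoc).1 (terminationUniform_singletonWeb rfl N))

end

end LinkedData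

theorem mainTheorem7 :
    ¬ LinkedData.LDMachineDecidable Set.univ LinkedData.encSatQuery
        LinkedData.TerminationUniform ∧
    ¬ LinkedData.LDMachineDecidable Set.univ LinkedData.encSatQuery
        LinkedData.TerminationOn :=
  ⟨LinkedData.not_decidable_terminationUniform, LinkedData.not_decidable_terminationOn⟩
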